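/- Let $G\subset\mathbb{C}$ be a non-empty open connected set and let $v:G\to[0,\infty[$ be an arbitrary function (a weight). Let $H(G)$ be the space of holomorphic functions on $G$, and put $$H^\infty_v(G)=\Bigl\{f\in H(G)\ \Big|\ \|f\|_v:=\sup_{z\in G}v(z)|f(z)|<\infty\Bigr\},\qquad E_v=\{z\in G\mid v(z)>0\}.$$ Let $\tau_v$ be the topology on $H^\infty_v(G)$ induced by the seminorm $\|\cdot\|_v$, and let $\tau_{co}$ be the topology of uniform convergence on the compact subsets of $G$, restricted to $H^\infty_v(G)$. Let $(K_n)_n$ be an increasing sequence of compact subsets of $G$ such that every compact subset of $G$ is contained in some $K_n$, and let $\tau$ be the locally convex topology on $H^\infty_v(G)$ generated by the seminorms $$\|f\|_n:=\sup_{z\in K_n}|f(z)|+\|f\|_v,\qquad n\in\mathbb{N}.$$ For a weight $w$, we say that $H^\infty_w(G)$ is a Banach space if $\|\cdot\|_w$ is a norm on $H^\infty_w(G)$ for which the space is complete. A topology on a complex vector space is called normable if it is induced by a norm. (i) The following are equivalent: $\tau$ is coarser than (or equal to) $\tau_v$; $\tau=\tau_v$; $H^\infty_v(G)$ is a Banach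 space. (ii) $\tau$ is normable if and only if there is a compact set $K\subset G$ such that $H^\infty_w(G)$ is a Banach space for the weight $w:=v+\chi_K$, where $\chi_K$ is the characteristic function of $K$. (iii) If $E_v$ is contained in a compact subset of $G$ and $v$ is bounded, then $\tau=\tau_{co}$ on $H^\infty_v(G)$. Conversely, if $H^\infty_v(G)$ contains (the restrictions to $G$ of) all polynomials, $G$ is simply connected and $\tau=\tau_{co}$ on $H^\infty_v(G)$, then $E_v$ is contained in a compact subset of $G$ and $v$ is bounded. (iv) If $\tau$ is normable, then $E_v$ is not discrete, that is, $E_v$ has a limit point in $G$. -/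

import Mathlib

open scoped NNReal

noncomputable section

/-- The uniform structure of the pseudometric `(x, y) ↦ p (x - y)` of a seminorm `p`. -/
@[reducible] def seminormUniformSpace {E : Type*} [AddCommGroup E] [Module ℂ E]
    (p : Seminorm ℂ E) : UniformSpace E :=
  p.toAddGroupSeminorm.toSeminormedAddCommGroup.toPseudoMetricSpace.toUniformSpace

/-- The topology induced by a single seminorm `p`. -/
@[reducible] def seminormTopology {E : Type*} [AddCommGroup E] [Module ℂ E]
    (p : Seminorm ℂ E) : TopologicalSpace E :=
  (seminormUniformSpace p).toTopologicalSpace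

/-- The seminorm `p` is a norm. -/
def SeminormIsNorm {E : Type*} [AddCommGroup E] [Module ℂ E] (p : Seminorm ℂ E) : Prop :=
  ∀ x, p x = 0 → x = 0

/-- A topology on a complex vector space is normable if it is induced by a norm. -/
def IsNormableTopology {E : Type*} [AddCommGroup E] [Module ℂ E]
    (t : TopologicalSpace E) : Prop :=
  ∃ p : Seminorm ℂ E, SeminormIsNorm p ∧ t = seminormTopology p

/-- `(E, p)` is a Banach space: `p` is a norm and `E` is complete for it. -/
def SeminormIsBanach {E : Type*} [AddCommGroup E] [Module ℂ E] (p : Seminorm ℂ E) : Prop :=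
  SeminormIsNorm p ∧ @CompleteSpace E (seminormUniformSpace p)

/-- `H(G)`: the holomorphic functions on `G`, as functions defined on `G` only. -/
def Holomorphic (G : Set ℂ) : Submodule ℂ C(G, ℂ) where
  carrier := {f | ∃ F : ℂ → ℂ, DifferentiableOn ℂ F G ∧ ∀ z : G, F z = f z}
  zero_mem' := ⟨fun _ => 0, differentiableOn_const 0, fun _ => rfl⟩
  add_mem' := by
    rintro f g ⟨F, hF, hFf⟩ ⟨F', hF', hFg⟩
    exact ⟨fun z => F z + F' z, hF.add hF', fun z => by simp [hFf, hFg]⟩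
  smul_mem' := by
    rintro c f ⟨F, hF, hFf⟩
    exact ⟨fun z => c * F z, hF.const_mul c, fun z => by simp [hFf]⟩

/-- `H^∞_v(G)`: the holomorphic functions `f` on `G` with `sup_{z ∈ G} v(z) |f(z)| < ∞`. -/
def WeightedHol {G : Set ℂ} (v : G → ℝ≥0) : Submodule ℂ C(G, ℂ) where
  carrier := {f | f ∈ Holomorphic G ∧ BddAbove (Set.range fun z : G => (v z : ℝ) * ‖f z‖)}
  zero_mem' := by
    refine ⟨zero_mem _, 0, ?_⟩
    rintro _ ⟨z, rfl⟩
    simp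
  add_mem' := by
    rintro f g ⟨hf, A, hA⟩ ⟨hg, B, hB⟩
    refine ⟨add_mem hf hg, A + B, ?_⟩
    rintro _ ⟨z, rfl⟩
    have h1 := hA ⟨z, rfl⟩
    have h2 := hB ⟨z, rfl⟩
    have h3 := mul_le_mul_of_nonneg_left (norm_add_le (f z) (g z)) (v z).coe_nonneg
    simp only [ContinuousMap.add_apply] at *
    linarith
  smul_mem' := by
    rintro c f ⟨hf, A, hA⟩
    refine ⟨Submodule.smul_mem _ c hf, ‖c‖ * A, ?_⟩
    rintro _ ⟨z, rfl⟩
    have h1 := mul_le_mul_of_nonneg_left (hA ⟨z, rfl⟩) (norm_nonneg c)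
    simp only [ContinuousMap.smul_apply, norm_smul] at *
    linarith

/-- The seminorm `‖f‖_v = sup_{z ∈ G} v(z) |f(z)|` on `H^∞_v(G)`. -/
def weightSeminorm {G : Set ℂ} (v : G → ℝ≥0) : Seminorm ℂ (WeightedHol v) :=
  Seminorm.of (fun f => ⨆ z : G, (v z : ℝ) * ‖f.1 z‖)
    (fun f g => by
      refine Real.iSup_le (fun z => ?_) (add_nonneg
        (Real.iSup_nonneg fun z => by positivity) (Real.iSup_nonneg fun z => by positivity))
      have h1 := le_ciSup f.2.2 z
      have h2 := le_ciSup g.2.2 z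
      have h3 := mul_le_mul_of_nonneg_left (norm_add_le (f.1 z) (g.1 z)) (v z).coe_nonneg
      simp only [Submodule.coe_add, ContinuousMap.add_apply] at *
      linarith)
    (fun c f => by
      rw [Real.mul_iSup_of_nonneg (norm_nonneg c)]
      refine iSup_congr fun z => ?_
      simp only [Submodule.coe_smul, ContinuousMap.smul_apply, norm_smul]
      ring)

/-- The seminorm `f ↦ sup_{z ∈ K} |f(z)|` on `H^∞_v(G)`, for a compact subset `K` of `G`. -/
def compactSeminorm {G : Set ℂ} (v : G → ℝ≥0) (K : TopologicalSpace.Compacts G) :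
    Seminorm ℂ (WeightedHol v) :=
  have bdd (f : WeightedHol v) : BddAbove (Set.range fun z : (K : Set G) => ‖f.1 z‖) := by
    have h := (K.isCompact.image (f.1.continuous.norm)).bddAbove
    rwa [Set.image_eq_range] at h
  Seminorm.of (fun f => ⨆ z : (K : Set G), ‖f.1 z‖)
    (fun f g => by
      refine Real.iSup_le (fun z => ?_) (add_nonneg
        (Real.iSup_nonneg fun z => norm_nonneg _) (Real.iSup_nonneg fun z => norm_nonneg _))
      exact (norm_add_le (f.1 z) (g.1 z)).trans
        (add_le_add (le_ciSup (bdd f) z) (le_ciSup (bdd g) z)))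
    (fun c f => by
      rw [Real.mul_iSup_of_nonneg (norm_nonneg c)]
      refine iSup_congr fun z => ?_
      simp only [Submodule.coe_smul, ContinuousMap.smul_apply, norm_smul])

/-- A fundamental sequence of compact subsets of `G`: an increasing sequence of compact subsets
of `G` such that every compact subset of `G` is contained in one of them. -/
structure IsFundamentalSequence {G : Set ℂ} (K : ℕ → TopologicalSpace.Compacts G) : Prop where
  monotone : Monotone K
  exists_le : ∀ L : TopologicalSpace.Compacts G, ∃ n, L ≤ K n

/-- The topology `τ_v` on `H^∞_v(G)` induced by the seminorm `‖·‖_v`. -/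
@[reducible] def tauV {G : Set ℂ} (v : G → ℝ≥0) : TopologicalSpace (WeightedHol v) :=
  seminormTopology (weightSeminorm v)

/-- The compact-open topology `τ_co` restricted to `H^∞_v(G)`. -/
@[reducible] def tauCo {G : Set ℂ} (v : G → ℝ≥0) : TopologicalSpace (WeightedHol v) :=
  TopologicalSpace.induced (fun f => (f : C(G, ℂ))) ContinuousMap.compactOpen

/-- The locally convex topology `τ` on `H^∞_v(G)` generated by the sequence of (semi)norms
`‖f‖_n = sup_{z ∈ K_n} |f(z)| + ‖f‖_v`. -/
@[reducible] def tau {G : Set ℂ} (v : G → ℝ≥0) (K : ℕ → TopologicalSpace.Compacts G) :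
    TopologicalSpace (WeightedHol v) :=
  SeminormFamily.moduleFilterBasis
    (fun n : ℕ => compactSeminorm v (K n) + weightSeminorm v : SeminormFamily ℂ _ ℕ) |>.topology

/-- `E_v = {z ∈ G | v(z) > 0}`. -/
def positivitySet {G : Set ℂ} (v : G → ℝ≥0) : Set G := {z | 0 < v z}

/-- A subset of `G` is called discrete here if it has no limit point in `G`. -/
def HasNoLimitPoint {G : Set ℂ} (E : Set G) : Prop :=
  ∀ z : G, ¬ AccPt z (Filter.principal E)

/-- The weight `v + χ_K`. -/
def weightAddIndicator {G : Set ℂ} (v : G → ℝ≥0) (K : TopologicalSpace.Compacts G) : G → ℝ≥0 :=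
  fun z => v z + Set.indicator (K : Set G) (fun _ => 1) z

end

open Filter Topology Set TopologicalSpace

/-! ### Topologies defined by seminorms, and the closed graph theorem -/

section Seminorms

variable {E : Type*} [AddCommGroup E] [Module ℂ E]

/-! Everything rests on one estimate, `WeightDominates`: each sup over $K_n$ is at most a constant
times $\|f\|_v$. Comparing seminorms, it says that $\tau$ is coarser than $\tau_v$; for $v+\chi_L$
with some compact $L$ in place of $v$, it says that $\tau$ is normable.

The estimate is equivalent to completeness. If it holds, a Cauchy sequence converges uniformly on
compact sets, so its limit is holomorphic. Conversely, in the Banach case $E_v$ has a limit point: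
otherwise a Weierstrass product vanishes on $E_v$ but not identically, and has norm zero.
Evaluations at points of $E_v$ are continuous, so the closed graph and identity theorems bound all
evaluations on a disc around the limit point (`SeminormIsBanach.bound_on_closedBall`). Connectedness
of $G$ spreads the bound.

In the converse of (iii), powers of polynomials force $v = 0$ off the polynomial hull of some $K_n$;
simple connectedness keeps this hull inside $G$. For (iv), functions $h g^k$, with $h \ne 0$
vanishing on $E_v$ and $g$ unbounded, violate the estimate if $E_v$ has no limit point. -/

theorem withSeminorms_seminormTopology (p : Seminorm ℂ E) :
    WithSeminorms (topology := seminormTopology p) (fun _ : Unit => p) := by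
  let : SeminormedAddCommGroup E := p.toAddGroupSeminorm.toSeminormedAddCommGroup
  let : NormedSpace ℂ E := ⟨fun a x => (map_smul_eq_mul p a x).le⟩
  exact (norm_withSeminorms ℂ E).congr (fun _ => ⟨{0}, 1, fun x => by simp; rfl⟩)
    (fun _ => ⟨{()}, 1, fun x => by simp; rfl⟩)

/-- Comparison of two topologies generated by monotone families of seminorms. -/
theorem withSeminorms_le_iff {ι κ : Type*} [SemilatticeSup ι] [Nonempty ι]
    {p : SeminormFamily ℂ E ι} {q : SeminormFamily ℂ E κ} (hp : Monotone p)
    {t s : TopologicalSpace E} (ht : WithSeminorms (topology := t) p)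
    (hs : WithSeminorms (topology := s) q) :
    t ≤ s ↔ ∀ i, ∃ j, ∃ C : ℝ, ∀ x, q i x ≤ C * p j x := by
  constructor
  · intro hts i
    have hc : @Continuous _ _ t _ (q i) :=
      continuous_le_dom hts (@WithSeminorms.continuous_seminorm _ _ _ _ _ _ s q hs i)
    obtain ⟨S, C, -, hC⟩ := @Seminorm.bound_of_continuous _ _ _ _ _ _ p t ht (q i) hc
    obtain ⟨j, hj⟩ := S.exists_le
    refine ⟨j, C, fun x => (hC x).trans ?_⟩
    rw [smul_apply, NNReal.smul_def, smul_eq_mul]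
    gcongr
    exact Finset.sup_le (f := p) (fun k hk => hp (hj k hk)) x
  · intro h
    rw [← continuous_id_iff_le]
    refine WithSeminorms.continuous_of_isBounded ht hs LinearMap.id fun i => ?_
    obtain ⟨j, C, hC⟩ := h i
    refine ⟨{j}, C.toNNReal, fun x => ?_⟩
    rw [Finset.sup_singleton, smul_apply, NNReal.smul_def, smul_eq_mul]
    exact (hC x).trans (mul_le_mul_of_nonneg_right (Real.le_coe_toNNReal C) (apply_nonneg _ _))

/-- Closed graph theorem for a linear map on a space that is Banach for the norm `p`. -/
theorem SeminormIsBanach.bound_of_closed_graph {p : Seminorm ℂ E} (hp : SeminormIsBanach p)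
    {F : Type*} [NormedAddCommGroup F] [NormedSpace ℂ F] [CompleteSpace F] (T : E →ₗ[ℂ] F)
    (hT : ∀ (u : ℕ → E) (y : F), Tendsto (fun n => p (u n)) atTop (𝓝 0) →
      Tendsto (fun n => T (u n)) atTop (𝓝 y) → y = 0) :
    ∃ C : ℝ, ∀ x, ‖T x‖ ≤ C * p x := by
  obtain ⟨hn, hcompl⟩ := hp
  let : SeminormedAddCommGroup E := p.toAddGroupSeminorm.toSeminormedAddCommGroup
  let : NormedAddCommGroup E := NormedAddCommGroup.ofSeparation hn
  let : NormedSpace ℂ E := ⟨fun a x => (map_smul_eq_mul p a x).le⟩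
  have : CompleteSpace E := hcompl
  have hc : Continuous T := by
    refine T.continuous_of_seq_closed_graph fun u x y hu hTu => ?_
    have := hT (fun n => u n - x) (y - T x) (tendsto_iff_norm_sub_tendsto_zero.1 hu) (by
      simp only [map_sub]
      exact hTu.sub_const (T x))
    exact sub_eq_zero.1 this
  exact ⟨‖(⟨T, hc⟩ : E →L[ℂ] F)‖, fun x => (⟨T, hc⟩ : E →L[ℂ] F).le_opNorm x⟩

theorem seminorm_completeSpace {p : Seminorm ℂ E}
    (h : ∀ u : ℕ → E, (∀ ε > 0, ∃ N, ∀ m ≥ N, ∀ n ≥ N, p (u m - u n) < ε) →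
      ∃ x, ∀ ε > 0, ∃ N, ∀ n ≥ N, p (u n - x) < ε) :
    @CompleteSpace E (seminormUniformSpace p) := by
  let : SeminormedAddCommGroup E := p.toAddGroupSeminorm.toSeminormedAddCommGroup
  refine Metric.complete_of_cauchySeq_tendsto fun u hu => ?_
  obtain ⟨x, hx⟩ := h u fun ε hε => by
    obtain ⟨N, hN⟩ := Metric.cauchySeq_iff.1 hu ε hε
    exact ⟨N, fun m hm n hn => by
      have := hN m hm n hn
      rw [dist_eq_norm_sub] at this
      exact this⟩
  refine ⟨x, Metric.tendsto_atTop.2 fun ε hε => ?_⟩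
  obtain ⟨N, hN⟩ := hx ε hε
  exact ⟨N, fun n hn => by rw [dist_eq_norm_sub]; exact hN n hn⟩

end Seminorms

/-! ### Weierstrass products on an open set -/

section ZeroSets

/-- Closed bounded subsets exhausting an open set `G`. -/
def discExhaustion (G : Set ℂ) (m : ℕ) : Set ℂ :=
  {z | ‖z‖ ≤ m ∧ ∀ b ∉ G, 1 / ((m : ℝ) + 1) ≤ dist z b}

theorem discExhaustion_mono (G : Set ℂ) : Monotone (discExhaustion G) := by
  intro m n hmn z hz
  have h : (m : ℝ) ≤ n := mod_cast hmn
  exact ⟨hz.1.trans h, fun b hb => le_trans (by gcongr) (hz.2 b hb)⟩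

theorem discExhaustion_subset (G : Set ℂ) (m : ℕ) : discExhaustion G m ⊆ G := by
  intro z hz
  by_contra h
  have h1 := hz.2 z h
  rw [dist_self] at h1
  have : (0 : ℝ) < 1 / ((m : ℝ) + 1) := by positivity
  linarith

theorem isCompact_discExhaustion (G : Set ℂ) (m : ℕ) : IsCompact (discExhaustion G m) := by
  refine (isCompact_closedBall (0 : ℂ) m).of_isClosed_subset ?_ fun z hz => by simpa using hz.1
  have : discExhaustion G m =
      {z | ‖z‖ ≤ m} ∩ ⋂ b ∈ Gᶜ, {z | 1 / ((m : ℝ) + 1) ≤ dist z b} := by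
    ext z
    simp [discExhaustion]
  rw [this]
  refine (isClosed_le continuous_norm continuous_const).inter
    (isClosed_biInter fun b _ => isClosed_le continuous_const (by fun_prop))

theorem exists_discExhaustion_mem_nhds {G : Set ℂ} (hG : IsOpen G) {z : ℂ} (hz : z ∈ G) :
    ∃ m, discExhaustion G m ∈ 𝓝 z := by
  obtain ⟨ε, hε, hb⟩ := Metric.isOpen_iff.1 hG z hz
  obtain ⟨m₁, h₁⟩ := exists_nat_one_div_lt (half_pos hε)
  obtain ⟨m₂, h₂⟩ := exists_nat_ge (‖z‖ + ε)
  refine ⟨max m₁ m₂, ?_⟩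
  filter_upwards [Metric.ball_mem_nhds z (half_pos hε)] with y hy
  have hy' : dist y z < ε / 2 := hy
  constructor
  · have h3 : ‖y‖ ≤ ‖z‖ + dist y z := by
      rw [dist_eq_norm]
      simpa using norm_add_le z (y - z)
    have : (m₂ : ℝ) ≤ (max m₁ m₂ : ℕ) := mod_cast le_max_right _ _
    linarith
  · intro b hbG
    have h4 : ε ≤ dist b z := not_lt.1 fun h => hbG (hb h)
    have h5 := dist_triangle b y z
    rw [dist_comm b y] at h5
    have h6 : 1 / (((max m₁ m₂ : ℕ) : ℝ) + 1) ≤ 1 / ((m₁ : ℝ) + 1) := by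
      gcongr
      exact le_max_left _ _
    linarith

/-- A point outside the exhausting set can be separated from it by a holomorphic function. -/
theorem exists_separating_of_notMem_discExhaustion {G : Set ℂ} {m : ℕ} {a : ℂ}
    (ha : a ∉ discExhaustion G m) :
    ∃ u : ℂ → ℂ, DifferentiableOn ℂ u G ∧ u a = 1 ∧
      ∃ ρ : ℝ, 0 ≤ ρ ∧ ρ < 1 ∧ ∀ z ∈ discExhaustion G m, ‖u z‖ ≤ ρ := by
  by_cases h : ‖a‖ ≤ m
  · have : ∃ b ∉ G, dist a b < 1 / ((m : ℝ) + 1) := by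
      by_contra! h'
      exact ha ⟨h, h'⟩
    obtain ⟨b, hb, hab⟩ := this
    by_cases hab' : a = b
    -- Here $a \notin G$, so the point indicator is zero throughout $G$, hence holomorphic there.
    · refine ⟨fun z => if z = a then 1 else 0, ?_, by simp, 0, le_rfl, one_pos, ?_⟩
      · refine (differentiableOn_const (0 : ℂ)).congr fun z hz => if_neg ?_
        rintro rfl
        exact hb (hab' ▸ hz)
      · intro z hz
        have hza : z ≠ a := fun h => ha (h ▸ hz)
        simp [hza]
    -- The pole $b$ lies off $G$, closer than $1/(m+1)$ to $a$ but at least that far from the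
    -- exhausting set.
    refine ⟨fun z => (a - b) / (z - b), ?_, div_self (sub_ne_zero.2 hab'),
      dist a b * (m + 1), by positivity, ?_, ?_⟩
    · refine DifferentiableOn.div (by fun_prop) (by fun_prop) fun z hz => sub_ne_zero.2 ?_
      rintro rfl
      exact hb hz
    · rwa [lt_div_iff₀ (by positivity)] at hab
    · intro z hz
      have h1 := hz.2 b hb
      have h2 : (0 : ℝ) < 1 / ((m : ℝ) + 1) := by positivity
      rw [norm_div, ← dist_eq_norm, ← dist_eq_norm, div_le_iff₀ (h2.trans_le h1)]
      calc dist a b = dist a b * (m + 1) * (1 / ((m : ℝ) + 1)) := by field_simp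
        _ ≤ _ := by gcongr
  · push Not at h
    have ha0 : 0 < ‖a‖ := (Nat.cast_nonneg m).trans_lt h
    refine ⟨fun z => z / a, by fun_prop, div_self (norm_pos_iff.1 ha0), m / ‖a‖, by positivity,
      (div_lt_one ha0).2 h, fun z hz => ?_⟩
    rw [norm_div]
    gcongr
    exact hz.1

/-- Finitely many zeros can be prescribed by a holomorphic function that is close to `1` on an
exhausting set. -/
theorem exists_zero_finset_near_one {G : Set ℂ} {m : ℕ} (S : Finset ℂ)
    (hS : ∀ a ∈ S, a ∉ discExhaustion G m) {ε : ℝ} (hε : 0 < ε) :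
    ∃ F : ℂ → ℂ, DifferentiableOn ℂ F G ∧ (∀ a ∈ S, F a = 0) ∧
      ∀ z ∈ discExhaustion G m, ‖F z - 1‖ ≤ ε := by
  classical
  induction S using Finset.induction_on generalizing ε with
  | empty => exact ⟨fun _ => 1, by fun_prop, by simp, by simp [hε.le]⟩
  | insert a S _ ih =>
    obtain ⟨F, hF, hF0, hF1⟩ := ih (fun b hb => hS b (Finset.mem_insert_of_mem hb)) (half_pos hε)
    obtain ⟨u, hu, hua, ρ, hρ0, hρ1, hρ⟩ :=
      exists_separating_of_notMem_discExhaustion (hS a (Finset.mem_insert_self a S))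
    -- Since $|F| \le 1 + ε/2$ on the exhausting set, this bound on $u^N$ lets the new factor cost
    -- only another $ε/2$.
    have hpos : 0 < ε / 2 / (1 + ε / 2) := by positivity
    obtain ⟨N, hN⟩ := exists_pow_lt_of_lt_one hpos hρ1
    refine ⟨fun z => F z * (1 - u z ^ N), by fun_prop, ?_, fun z hz => ?_⟩
    · intro b hb
      rcases Finset.mem_insert.1 hb with rfl | hb
      · simp [hua]
      · simp [hF0 b hb]
    · have h1 : ‖u z ^ N‖ ≤ ε / 2 / (1 + ε / 2) := by
        rw [norm_pow]
        exact (pow_le_pow_left₀ (norm_nonneg _) (hρ z hz) N).trans hN.le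
      have h2 := hF1 z hz
      have h3 : ‖F z‖ ≤ 1 + ε / 2 := by
        have := norm_add_le (F z - 1) 1
        rw [sub_add_cancel, norm_one] at this
        linarith
      calc ‖F z * (1 - u z ^ N) - 1‖ = ‖(F z - 1) - F z * u z ^ N‖ := by congr 1; ring
        _ ≤ ‖F z - 1‖ + ‖F z‖ * ‖u z ^ N‖ := (norm_sub_le _ _).trans_eq (by rw [norm_mul])
        _ ≤ ε / 2 + (1 + ε / 2) * (ε / 2 / (1 + ε / 2)) := by gcongr
        _ = ε := by field_simp; ring

/-- A set without limit points in `G` is contained in the zero set of a holomorphic function that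
does not vanish at a given point off the set. -/
theorem exists_holomorphic_zero_on {G : Set ℂ} (hG : IsOpen G) {S : Set ℂ}
    (hS : ∀ z ∈ G, ¬ AccPt z (𝓟 S)) {p : ℂ} (hp : p ∈ G) (hpS : p ∉ S) :
    ∃ f : ℂ → ℂ, DifferentiableOn ℂ f G ∧ f p ≠ 0 ∧ ∀ z ∈ S, z ∈ G → f z = 0 := by
  obtain ⟨m₀, hm₀⟩ := exists_discExhaustion_mem_nhds hG hp
  let L : ℕ → Set ℂ := fun k => discExhaustion G (m₀ + k)
  have hLmono : Monotone L := fun i j hij => discExhaustion_mono G (by omega)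
  have hpL : ∀ k, p ∈ L k := fun k => hLmono (Nat.zero_le k) (mem_of_mem_nhds hm₀)
  have hfin : ∀ k, (S ∩ L k).Finite := by
    intro k
    by_contra hinf
    obtain ⟨z, hz, hacc⟩ := Set.Infinite.exists_accPt_of_subset_isCompact hinf
      (isCompact_discExhaustion G (m₀ + k)) inter_subset_right
    exact hS z (discExhaustion_subset _ _ hz) (hacc.mono (principal_mono.2 inter_subset_left))
  -- The $k$-th factor kills the finitely many points of $S$ in the $k$-th shell; those in `L 0` are
  -- left to the polynomial `P`.
  have hex : ∀ k, ∃ F : ℂ → ℂ, DifferentiableOn ℂ F G ∧ (∀ a ∈ S ∩ L (k + 1), a ∉ L k → F a = 0) ∧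
      ∀ z ∈ L k, ‖F z - 1‖ ≤ (1 / 2) ^ (k + 1) := by
    intro k
    classical
    obtain ⟨F, h1, h2, h3⟩ := exists_zero_finset_near_one (G := G) (m := m₀ + k)
      ((hfin (k + 1)).toFinset.filter (· ∉ L k)) (fun a ha => (Finset.mem_filter.1 ha).2)
      (ε := (1 / 2) ^ (k + 1)) (by positivity)
    exact ⟨F, h1, fun a ha ha' => h2 a (by simpa [ha'] using ha), h3⟩
  choose F hFd hF0 hF1 using hex
  let P : ℂ → ℂ := fun z => ∏ a ∈ (hfin 0).toFinset, (z - a)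
  let g : ℕ → ℂ → ℂ := fun k z => F k z - 1
  have hgF : ∀ k z, 1 + g k z = F k z := fun k z => by simp [g]
  have hsum : Summable fun k : ℕ => (1 / 2 : ℝ) ^ (k + 1) :=
    (summable_nat_add_iff 1).2 summable_geometric_two
  have hbound : ∀ j k, j ≤ k → ∀ z ∈ L j, ‖g k z‖ ≤ (1 / 2) ^ (k + 1) :=
    fun j k hjk z hz => hF1 k z (hLmono hjk hz)
  have hdiff : DifferentiableOn ℂ (fun z => ∏' k, (1 + g k z)) G := by
    intro z hz
    obtain ⟨j, hj⟩ := exists_discExhaustion_mem_nhds hG hz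
    have hj' : L j ∈ 𝓝 z := mem_of_superset hj (discExhaustion_mono G (by omega))
    have hsub : interior (L j) ⊆ G := interior_subset.trans (discExhaustion_subset _ _)
    have hprod := Summable.hasProdLocallyUniformlyOn_nat_one_add (f := g) (K := interior (L j))
      isOpen_interior hsum
      (eventually_atTop.2 ⟨j, fun k hk z hz => hbound j k hk z (interior_subset hz)⟩)
      (fun k => ((hFd k).continuousOn.mono hsub).sub continuousOn_const)
    have hd := TendstoLocallyUniformlyOn.differentiableOn hprod
      (.of_forall fun s => DifferentiableOn.fun_finsetProd fun k _ => by
        simp only [hgF]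
        exact (hFd k).mono hsub) isOpen_interior
    exact (hd.differentiableAt (isOpen_interior.mem_nhds
      (mem_interior_iff_mem_nhds.2 hj'))).differentiableWithinAt
  refine ⟨fun z => P z * ∏' k, (1 + g k z), DifferentiableOn.mul (by fun_prop) hdiff,
    mul_ne_zero ?_ ?_, ?_⟩
  · refine Finset.prod_ne_zero_iff.2 fun a ha h => hpS ?_
    rw [sub_eq_zero.1 h]
    exact ((hfin 0).mem_toFinset.1 ha).1
  -- As $p$ lies in every `L k`, each factor is within $1/2$ of $1$ at $p$, so none vanishes there.
  · refine tprod_one_add_ne_zero_of_summable (fun k h => ?_)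
      (hsum.of_nonneg_of_le (fun _ => norm_nonneg _) fun k => hbound 0 k (Nat.zero_le k) p (hpL 0))
    have h1 := hbound 0 k (Nat.zero_le k) p (hpL 0)
    rw [eq_neg_of_add_eq_zero_right h, norm_neg, norm_one] at h1
    have h2 : (1 / 2 : ℝ) ^ (k + 1) < 1 := pow_lt_one₀ (by norm_num) (by norm_num) (by omega)
    linarith
  · intro z hzS hzG
    have hzL : ∃ j, z ∈ L j := by
      obtain ⟨j, hj⟩ := exists_discExhaustion_mem_nhds hG hzG
      exact ⟨j, discExhaustion_mono G (by omega) (mem_of_mem_nhds hj)⟩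
    classical
    rcases hn : Nat.find hzL with _ | k
    · have h0 := Nat.find_spec hzL
      rw [hn] at h0
      have : P z = 0 := Finset.prod_eq_zero ((hfin 0).mem_toFinset.2 ⟨hzS, h0⟩) (sub_self z)
      simp [this]
    · have h1 := Nat.find_spec hzL
      rw [hn] at h1
      have h2 : z ∉ L k := Nat.find_min hzL (by omega)
      have : ∏' k, (1 + g k z) = 0 := tprod_of_exists_eq_zero ⟨k, by
        rw [hgF]; exact hF0 k z ⟨hzS, h1⟩ h2⟩
      simp only [this, mul_zero]

end ZeroSets

/-! ### Polynomial hulls in simply connected open sets -/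

section PolynomialHull

/-- The polynomially convex hull of a set `K`. -/
def polynomialHull (K : Set ℂ) : Set ℂ :=
  {a | ∀ P : Polynomial ℂ, ∀ ρ : ℝ, 0 ≤ ρ → (∀ z ∈ K, ‖P.eval z‖ ≤ ρ) → ‖P.eval a‖ ≤ ρ}

theorem isClosed_polynomialHull (K : Set ℂ) : IsClosed (polynomialHull K) := by
  simp only [polynomialHull, ofPred_forall]
  exact isClosed_iInter fun P => isClosed_iInter fun ρ => isClosed_iInter fun _ =>
    isClosed_iInter fun _ => isClosed_le (by fun_prop) continuous_const

theorem isCompact_polynomialHull {K : Set ℂ} (hK : IsCompact K) :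
    IsCompact (polynomialHull K) := by
  obtain ⟨R, hR0, hR⟩ := hK.isBounded.exists_pos_norm_le
  refine (isCompact_closedBall (0 : ℂ) R).of_isClosed_subset (isClosed_polynomialHull K)
    fun a ha => ?_
  simpa using ha Polynomial.X R hR0.le (by simpa using hR)

theorem exists_polynomial_of_notMem_polynomialHull {K : Set ℂ} {a : ℂ}
    (ha : a ∉ polynomialHull K) :
    ∃ P : Polynomial ℂ, ∃ ρ : ℝ, 0 ≤ ρ ∧ ρ < 1 ∧ P.eval a = 1 ∧ ∀ z ∈ K, ‖P.eval z‖ ≤ ρ := by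
  simp only [polynomialHull, mem_ofPred_eq, not_forall, not_le] at ha
  obtain ⟨P, ρ, hρ0, hρ, hlt⟩ := ha
  have h0 : 0 < ‖P.eval a‖ := hρ0.trans_lt hlt
  refine ⟨Polynomial.C (P.eval a)⁻¹ * P, ρ / ‖P.eval a‖, by positivity, (div_lt_one h0).2 hlt,
    by simp [norm_pos_iff.1 h0], fun z hz => ?_⟩
  rw [Polynomial.eval_mul, Polynomial.eval_C, norm_mul, norm_inv, inv_mul_eq_div]
  gcongr
  exact hρ z hz

theorem notMem_polynomialHull {K : Set ℂ} {a : ℂ} {P : Polynomial ℂ} {ρ : ℝ} (hρ0 : 0 ≤ ρ)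
    (hρ1 : ρ < 1) (ha : P.eval a = 1) (hK : ∀ z ∈ K, ‖P.eval z‖ ≤ ρ) :
    a ∉ polynomialHull K := by
  intro h
  have := h P ρ hρ0 hK
  rw [ha, norm_one] at this
  linarith

/-- If `b` is off the hull of `K`, so is every point that is closer to `b` than half its distance
to `K`. -/
theorem notMem_polynomialHull_of_near {K : Set ℂ} {a b : ℂ} {δ : ℝ} (hδ : ∀ z ∈ K, δ ≤ dist z a)
    (hab : dist b a < δ / 2) (hb : b ∉ polynomialHull K) : a ∉ polynomialHull K := by
  obtain ⟨P, ρ, hρ0, hρ1, hPb, hP⟩ := exists_polynomial_of_notMem_polynomialHull hb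
  set d := dist b a with hd
  have hd0 : 0 ≤ d := dist_nonneg
  have hδ0 : 0 < δ - d := by linarith
  set q := d / (δ - d) with hq
  have hq0 : 0 ≤ q := by positivity
  have hq1 : q < 1 := (div_lt_one hδ0).2 (by linarith)
  obtain ⟨N, hN⟩ := exists_pow_lt_of_lt_one (show 0 < (1 - q) / 4 by linarith) hρ1
  obtain ⟨Q, hQ⟩ : (Polynomial.X - Polynomial.C b) ∣ 1 - P ^ N :=
    Polynomial.dvd_iff_isRoot.2 (by simp [hPb])
  -- Pole pushing: `Q` is $(1-P^N)/(z-b)$, an approximation of $1/(z-b)$ on $K$, and $(z-a)/(z-b)$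
  -- differs from $1$ by at most $q < 1$ there. The choice of $N$ makes $2ρ^N < (1-q)/2$.
  refine notMem_polynomialHull (P := 1 - (Polynomial.X - Polynomial.C a) * Q)
    (ρ := q + 2 * ρ ^ N) (by positivity) (by linarith) (by simp) fun z hz => ?_
  have hzb : δ - d ≤ dist z b := by
    have h1 := hδ z hz
    have h2 := dist_triangle z b a
    linarith
  have hzb0 : 0 < dist z b := hδ0.trans_le hzb
  have hne : z - b ≠ 0 := sub_ne_zero.2 (dist_pos.1 hzb0)
  have hev : (z - b) * Q.eval z = 1 - P.eval z ^ N := by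
    have := congrArg (Polynomial.eval z) hQ
    simpa using this.symm
  have heq : (1 - (Polynomial.X - Polynomial.C a) * Q).eval z =
      (a - b) / (z - b) + (1 + (b - a) / (z - b)) * P.eval z ^ N := by
    have : Q.eval z = (1 - P.eval z ^ N) / (z - b) := by rw [← hev]; field_simp
    simp only [Polynomial.eval_sub, Polynomial.eval_one, Polynomial.eval_mul, Polynomial.eval_X,
      Polynomial.eval_C, this]
    field_simp
    ring
  have hab1 : ‖(b - a) / (z - b)‖ ≤ q := by
    rw [norm_div, ← dist_eq_norm, ← dist_eq_norm]
    exact div_le_div_of_nonneg_left hd0 hδ0 hzb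
  have hab2 : ‖(a - b) / (z - b)‖ ≤ q := by
    rwa [← neg_sub b a, neg_div, norm_neg]
  have hPN : ‖P.eval z ^ N‖ ≤ ρ ^ N := by
    rw [norm_pow]
    exact pow_le_pow_left₀ (norm_nonneg _) (hP z hz) N
  have h2 : ‖1 + (b - a) / (z - b)‖ ≤ 2 := by
    have := norm_add_le 1 ((b - a) / (z - b))
    rw [norm_one] at this
    linarith
  rw [heq]
  calc _ ≤ ‖(a - b) / (z - b)‖ + ‖1 + (b - a) / (z - b)‖ * ‖P.eval z ^ N‖ :=
        (norm_add_le _ _).trans_eq (by rw [norm_mul])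
    _ ≤ q + 2 * ρ ^ N := by gcongr

/-- A point off the hull but near $a$ would transfer its separating polynomial to $a$. Consequently
the frontier of the hull lies in $K$, which permits gluing along $K$. -/
theorem isOpen_polynomialHull_diff {K : Set ℂ} (hK : IsCompact K) :
    IsOpen (polynomialHull K \ K) := by
  refine Metric.isOpen_iff.2 fun a ha => ?_
  obtain ⟨δ, hδ, hb⟩ := Metric.isOpen_iff.1 hK.isClosed.isOpen_compl a ha.2
  have hδ' : ∀ z ∈ K, δ ≤ dist z a := fun z hz => not_lt.1 fun h => hb h hz
  refine ⟨δ / 2, half_pos hδ, fun b hba => ⟨?_, hb (Metric.ball_subset_ball (by linarith) hba)⟩⟩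
  by_contra h
  exact notMem_polynomialHull_of_near hδ' hba h ha.1

/-- There is no continuous logarithm of `z - a` on a circle around `a`. -/
theorem not_exists_continuous_log_circle {g : ℂ → ℂ} (hg : Continuous g) (a : ℂ) {R : ℝ}
    (hR : 0 < R) (h : ∀ θ : ℝ, Complex.exp (g (a + R * Complex.exp (θ * Complex.I))) =
      R * Complex.exp (θ * Complex.I)) : False := by
  let ψ : ℝ → ℝ := fun θ => (g (a + R * Complex.exp (θ * Complex.I))).im - θ
  have hψ : Continuous ψ := by fun_prop
  have hint : ∀ θ, ∃ n : ℤ, ψ θ = n * (2 * Real.pi) := by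
    intro θ
    have h1 : Complex.exp (g (a + R * Complex.exp (θ * Complex.I))) =
        Complex.exp (Real.log R + θ * Complex.I) := by
      rw [h, Complex.exp_add, ← Complex.ofReal_exp, Real.exp_log hR]
    obtain ⟨n, hn⟩ := Complex.exp_eq_exp_iff_exists_int.1 h1
    refine ⟨n, ?_⟩
    have := congrArg Complex.im hn
    simp at this
    simp only [ψ, this]
    ring
  have hper : ψ (2 * Real.pi) = ψ 0 - 2 * Real.pi := by
    have : Complex.exp (((2 * Real.pi : ℝ) : ℂ) * Complex.I) =
        Complex.exp (((0 : ℝ) : ℂ) * Complex.I) := by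
      push_cast
      rw [Complex.exp_two_pi_mul_I]
      simp
    simp only [ψ, this]
    ring
  have hpi := Real.pi_pos
  -- `ψ` takes values in $2π\mathbb{Z}$ yet drops by $2π$ over one turn; the halfway value is not in
  -- the lattice.
  obtain ⟨θ, -, hθ⟩ := intermediate_value_Icc' (show (0 : ℝ) ≤ 2 * Real.pi by linarith)
    hψ.continuousOn (show ψ 0 - Real.pi ∈ Icc (ψ (2 * Real.pi)) (ψ 0) by
      rw [hper]; constructor <;> linarith)
  obtain ⟨n, hn⟩ := hint θ
  obtain ⟨k, hk⟩ := hint 0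
  rw [hn, hk] at hθ
  have h2 : (2 * n : ℝ) = 2 * k - 1 := by
    have : Real.pi * (2 * n - (2 * k - 1)) = 0 := by linarith
    rcases mul_eq_zero.1 this with h | h
    · exact absurd h hpi.ne'
    · linarith
  have h3 : 2 * n = 2 * k - 1 := by exact_mod_cast h2
  omega

/-- If $a$ were in the hull but off $G$, then $z-a$ would have a logarithm on $K$. Extending it
makes $z-a$, unchanged off the hull, into a zero-free continuous function on the plane. That
function has a logarithm, which is impossible on a large circle around $a$. -/
theorem polynomialHull_subset_of_isSimplyConnected {G K : Set ℂ} (hG : IsOpen G)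
    (hGs : IsSimplyConnected G) (hK : IsCompact K) (hKG : K ⊆ G) : polynomialHull K ⊆ G := by
  intro a ha
  by_contra haG
  obtain ⟨f, hf, hfexp⟩ := Complex.exists_continuousOn_eqOn_exp_comp hGs hG
    (g := fun z => z - a) (by fun_prop) (by
      rintro ⟨z, hz, hz0⟩
      exact haG (sub_eq_zero.1 hz0 ▸ hz))
  -- Tietze extension; off $K$ only continuity of `φ` matters, as its exponential never vanishes.
  obtain ⟨φ, hφ⟩ := ContinuousMap.exists_restrict_eq hK.isClosed
    (⟨K.domRestrict f, continuousOn_iff_continuous_domRestrict.1 (hf.mono hKG)⟩ : C(K, ℂ))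
  have hφK : ∀ z ∈ K, Complex.exp (φ z) = z - a := fun z hz => by
    have h1 : φ z = f z := congrArg (fun F : C(K, ℂ) => F ⟨z, hz⟩) hφ
    rw [h1]
    exact hfexp (hKG hz)
  classical
  let h : ℂ → ℂ := (polynomialHull K).piecewise (fun z => Complex.exp (φ z)) (fun z => z - a)
  have hfr : ∀ z ∈ frontier (polynomialHull K), z ∈ K := by
    intro z hz
    by_contra hzK
    rw [(isClosed_polynomialHull K).frontier_eq] at hz
    exact hz.2 (mem_interior.2 ⟨_, sdiff_subset, isOpen_polynomialHull_diff hK, hz.1, hzK⟩)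
  have hh : Continuous h :=
    Continuous.piecewise (fun z hz => hφK z (hfr z hz)) (by fun_prop) (by fun_prop)
  have hh0 : ∀ z, h z ≠ 0 := by
    intro z
    by_cases hz : z ∈ polynomialHull K
    · simp [h, hz]
    · simp only [h, Set.piecewise_eq_of_notMem _ _ _ hz]
      exact sub_ne_zero.2 fun e => hz (e ▸ ha)
  have huniv : IsSimplyConnected (univ : Set ℂ) := by
    have : ContractibleSpace (univ : Set ℂ) :=
      (Homeomorph.Set.univ ℂ).contractibleSpace_iff.2 inferInstance
    exact SimplyConnectedSpace.ofContractible _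
  obtain ⟨g, hg, hgexp⟩ := Complex.exists_continuousOn_eqOn_exp_comp huniv isOpen_univ
    (g := h) hh.continuousOn (by rintro ⟨z, -, hz⟩; exact hh0 z hz)
  obtain ⟨R, hR0, hR⟩ := ((isCompact_polynomialHull hK).isBounded).subset_ball_lt 0 a
  refine not_exists_continuous_log_circle (continuousOn_univ.1 hg) a hR0 fun θ => ?_
  have hout : a + R * Complex.exp (θ * Complex.I) ∉ polynomialHull K := by
    intro hmem
    have := hR hmem
    simp [Metric.mem_ball, dist_eq_norm, Complex.norm_exp_ofReal_mul_I, abs_of_pos hR0] at this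
  have := hgexp (mem_univ (a + R * Complex.exp (θ * Complex.I)))
  simp only [Function.comp_apply, h, Set.piecewise_eq_of_notMem _ _ _ hout] at this
  rw [this]
  ring

end PolynomialHull

/-! ### The topologies on the weighted space and normability -/

section WeightedSpaces

variable {G : Set ℂ}

/-- The restriction to `G` of a function that is holomorphic on `G`. -/
def holomorphicRestrict {F : ℂ → ℂ} (hF : DifferentiableOn ℂ F G) : C(G, ℂ) :=
  ⟨G.domRestrict F, continuousOn_iff_continuous_domRestrict.1 hF.continuousOn⟩

theorem holomorphicRestrict_mem {F : ℂ → ℂ} (hF : DifferentiableOn ℂ F G) :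
    holomorphicRestrict hF ∈ Holomorphic G :=
  ⟨F, hF, fun _ => rfl⟩

theorem le_weightSeminorm {v : G → ℝ≥0} (f : WeightedHol v) (z : G) :
    (v z : ℝ) * ‖f.1 z‖ ≤ weightSeminorm v f :=
  le_ciSup f.2.2 z

theorem weightSeminorm_le {v : G → ℝ≥0} (f : WeightedHol v) {C : ℝ} (hC : 0 ≤ C)
    (h : ∀ z, (v z : ℝ) * ‖f.1 z‖ ≤ C) : weightSeminorm v f ≤ C :=
  Real.iSup_le h hC

theorem le_compactSeminorm {v : G → ℝ≥0} {K : Compacts G} (f : WeightedHol v) {z : G}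
    (hz : z ∈ K) : ‖f.1 z‖ ≤ compactSeminorm v K f := by
  have h := (K.isCompact.image (f.1.continuous.norm)).bddAbove
  rw [Set.image_eq_range] at h
  exact le_ciSup h (⟨z, hz⟩ : (K : Set G))

theorem compactSeminorm_le {v : G → ℝ≥0} {K : Compacts G} (f : WeightedHol v) {C : ℝ}
    (hC : 0 ≤ C) (h : ∀ z ∈ K, ‖f.1 z‖ ≤ C) : compactSeminorm v K f ≤ C :=
  Real.iSup_le (fun z => h z.1 z.2) hC

theorem compactSeminorm_mono (v : G → ℝ≥0) : Monotone (compactSeminorm v) :=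
  fun _ _ hKL f => compactSeminorm_le f (apply_nonneg _ _) fun _ hz => le_compactSeminorm f (hKL hz)

/-- The compact subset of `G` corresponding to a compact set of the plane. -/
def compactsOfSubset {L : Set ℂ} (hL : IsCompact L) (hLG : L ⊆ G) : Compacts G :=
  ⟨(↑) ⁻¹' L, (IsInducing.subtypeVal.isCompact_preimage_iff (by simpa using hLG)).2 hL⟩

theorem IsFundamentalSequence.exists_mem {K : ℕ → Compacts G} (hK : IsFundamentalSequence K)
    (z : G) : ∃ n, z ∈ K n := by
  obtain ⟨n, hn⟩ := hK.exists_le ⟨{z}, isCompact_singleton⟩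
  exact ⟨n, hn (mem_singleton z)⟩

/-- The weight seminorm dominates all the suprema over compact sets. -/
def WeightDominates (v : G → ℝ≥0) (K : ℕ → Compacts G) : Prop :=
  ∀ n, ∃ C : ℝ, ∀ f, compactSeminorm v (K n) f ≤ C * weightSeminorm v f

section Topologies

variable (v : G → ℝ≥0) {K : ℕ → Compacts G}

theorem withSeminorms_tau (K : ℕ → Compacts G) : WithSeminorms (topology := tau v K)
    (fun n => compactSeminorm v (K n) + weightSeminorm v : SeminormFamily ℂ _ ℕ) :=
  .mk (topology := _) rfl

theorem monotone_compactSeminorm_add (hK : IsFundamentalSequence K) :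
    Monotone (fun n => compactSeminorm v (K n) + weightSeminorm v : SeminormFamily ℂ _ ℕ) :=
  fun _ _ hmn f => add_le_add (compactSeminorm_mono v (hK.monotone hmn) f) le_rfl

theorem tau_le_tauV (hK : IsFundamentalSequence K) : tau v K ≤ tauV v := by
  refine (withSeminorms_le_iff (monotone_compactSeminorm_add v hK) (withSeminorms_tau v K)
    (withSeminorms_seminormTopology (weightSeminorm v))).2 fun _ => ⟨0, 1, fun f => ?_⟩
  rw [one_mul]
  exact le_add_of_nonneg_left (apply_nonneg _ _)

theorem tauV_le_tau_iff : tauV v ≤ tau v K ↔ WeightDominates v K := by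
  rw [withSeminorms_le_iff (fun _ _ _ => le_rfl)
    (withSeminorms_seminormTopology (weightSeminorm v)) (withSeminorms_tau v K)]
  refine forall_congr' fun n => ⟨?_, ?_⟩
  · rintro ⟨-, C, hC⟩
    exact ⟨C, fun f => (le_add_of_nonneg_right (apply_nonneg _ _)).trans (hC f)⟩
  · rintro ⟨C, hC⟩
    refine ⟨(), C + 1, fun f => ?_⟩
    rw [add_one_mul]
    exact add_le_add (hC f) le_rfl

theorem withSeminorms_tauCo (hK : IsFundamentalSequence K) :
    WithSeminorms (topology := tauCo v)
      (fun n => compactSeminorm v (K n) : SeminormFamily ℂ _ ℕ) := by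
  let _ : TopologicalSpace (WeightedHol v) := tauCo v
  have : IsTopologicalAddGroup (WeightedHol v) :=
    topologicalAddGroup_induced (WeightedHol v).subtype
  refine (SeminormFamily.withSeminorms_iff_nhds_eq_iInf _).2 (le_antisymm ?_ ?_)
  · refine le_iInf fun n => tendsto_iff_comap.1 ?_
    have h0 : Tendsto (fun f : WeightedHol v => f.1) (𝓝 0) (𝓝 0) :=
      (continuous_induced_dom (f := fun f : WeightedHol v => f.1)).tendsto' _ _ rfl
    rw [ContinuousMap.tendsto_iff_forall_isCompact_tendstoUniformlyOn] at h0
    have h1 := Metric.tendstoUniformlyOn_iff.1 (h0 (K n) (K n).isCompact)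
    refine Metric.tendsto_nhds.2 fun ε hε => ?_
    filter_upwards [h1 (ε / 2) (half_pos hε)] with f hf
    rw [Real.dist_eq, sub_zero, abs_of_nonneg (apply_nonneg _ _)]
    refine (compactSeminorm_le f (half_pos hε).le fun z hz => ?_).trans_lt (half_lt_self hε)
    simpa using (hf z hz).le
  · rw [nhds_induced, ← tendsto_iff_comap]
    change Tendsto _ _ (𝓝 (0 : C(G, ℂ)))
    rw [ContinuousMap.tendsto_iff_forall_isCompact_tendstoUniformlyOn]
    intro L hL
    obtain ⟨n, hn⟩ := hK.exists_le ⟨L, hL⟩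
    have ht : Tendsto (compactSeminorm v (K n))
        (⨅ n, comap (compactSeminorm v (K n)) (𝓝 0)) (𝓝 0) :=
      tendsto_iff_comap.2 (iInf_le _ n)
    refine Metric.tendstoUniformlyOn_iff.2 fun ε hε => ?_
    filter_upwards [(tendsto_order.1 ht).2 ε hε] with f hf z hz
    simpa using (le_compactSeminorm f (hn hz)).trans_lt hf

end Topologies

/-- Enlarging the weight by the characteristic function of a compact set does not change the
space. -/
theorem weightedHol_weightAddIndicator (v : G → ℝ≥0) (L : Compacts G) :
    WeightedHol (weightAddIndicator v L) = WeightedHol v := by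
  ext f
  refine ⟨fun h => ⟨h.1, ?_⟩, fun h => ⟨h.1, ?_⟩⟩
  · obtain ⟨C, hC⟩ := h.2
    refine ⟨C, ?_⟩
    rintro _ ⟨z, rfl⟩
    refine le_trans ?_ (hC ⟨z, rfl⟩)
    simp only [weightAddIndicator, NNReal.coe_add]
    exact mul_le_mul_of_nonneg_right (le_add_of_nonneg_right (NNReal.coe_nonneg _)) (norm_nonneg _)
  · refine ⟨weightSeminorm v ⟨f, h⟩ + compactSeminorm v L ⟨f, h⟩, ?_⟩
    rintro _ ⟨z, rfl⟩
    simp only [weightAddIndicator, NNReal.coe_add, add_mul]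
    refine add_le_add (le_weightSeminorm (⟨f, h⟩ : WeightedHol v) z) ?_
    by_cases hz : z ∈ L
    · simpa [Set.indicator_of_mem (show z ∈ (L : Set G) from hz)] using
        le_compactSeminorm (⟨f, h⟩ : WeightedHol v) hz
    · simp [Set.indicator_of_notMem (show z ∉ (L : Set G) from hz)]

theorem weightSeminorm_weightAddIndicator_le {v : G → ℝ≥0} {L : Compacts G} {f : C(G, ℂ)}
    (hf : f ∈ WeightedHol v) (hf' : f ∈ WeightedHol (weightAddIndicator v L)) :
    weightSeminorm (weightAddIndicator v L) ⟨f, hf'⟩ ≤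
      compactSeminorm v L ⟨f, hf⟩ + weightSeminorm v ⟨f, hf⟩ := by
  refine weightSeminorm_le _ (by positivity) fun z => ?_
  simp only [weightAddIndicator, NNReal.coe_add, add_mul]
  rw [add_comm]
  refine add_le_add ?_ (le_weightSeminorm (⟨f, hf⟩ : WeightedHol v) z)
  by_cases hz : z ∈ L
  · simpa [Set.indicator_of_mem (show z ∈ (L : Set G) from hz)] using
      le_compactSeminorm (⟨f, hf⟩ : WeightedHol v) hz
  · simp [Set.indicator_of_notMem (show z ∉ (L : Set G) from hz)]

theorem weightSeminorm_le_weightAddIndicator {v : G → ℝ≥0} {L : Compacts G} {f : C(G, ℂ)}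
    (hf : f ∈ WeightedHol v) (hf' : f ∈ WeightedHol (weightAddIndicator v L)) :
    weightSeminorm v ⟨f, hf⟩ ≤ weightSeminorm (weightAddIndicator v L) ⟨f, hf'⟩ := by
  refine weightSeminorm_le _ (by positivity) fun z => le_trans ?_
    (le_weightSeminorm (⟨f, hf'⟩ : WeightedHol (weightAddIndicator v L)) z)
  simp only [weightAddIndicator, NNReal.coe_add]
  exact mul_le_mul_of_nonneg_right (le_add_of_nonneg_right (NNReal.coe_nonneg _)) (norm_nonneg _)

theorem compactSeminorm_le_weightAddIndicator {v : G → ℝ≥0} {L : Compacts G} {f : C(G, ℂ)}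
    (hf : f ∈ WeightedHol v) (hf' : f ∈ WeightedHol (weightAddIndicator v L)) :
    compactSeminorm v L ⟨f, hf⟩ ≤ weightSeminorm (weightAddIndicator v L) ⟨f, hf'⟩ := by
  refine compactSeminorm_le _ (by positivity) fun z hz => le_trans ?_
    (le_weightSeminorm (⟨f, hf'⟩ : WeightedHol (weightAddIndicator v L)) z)
  simp only [weightAddIndicator, NNReal.coe_add,
    Set.indicator_of_mem (show z ∈ (L : Set G) from hz), NNReal.coe_one]
  exact le_mul_of_one_le_left (norm_nonneg _) (by simp)

theorem seminormIsNorm_of_dominates {v : G → ℝ≥0} {K : ℕ → Compacts G}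
    (hK : IsFundamentalSequence K) {p : Seminorm ℂ (WeightedHol v)}
    (h : ∀ n, ∃ C : ℝ, ∀ f, compactSeminorm v (K n) f ≤ C * p f) : SeminormIsNorm p := by
  intro f hf
  ext z
  obtain ⟨n, hn⟩ := hK.exists_mem z
  obtain ⟨C, hC⟩ := h n
  have := (le_compactSeminorm f hn).trans (hC f)
  rw [hf, mul_zero] at this
  simpa using norm_le_zero_iff.1 this

/-- A norm inducing $\tau$ is bounded by a single $\|\cdot\|_n$, so $L = K_n$ works. Conversely
$\sup_L|f| + \|f\|_v$ is the norm; it is equivalent to the norm of $v+\chi_L$ up to a factor $2$. -/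
theorem isNormableTopology_tau_iff (v : G → ℝ≥0) {K : ℕ → Compacts G}
    (hK : IsFundamentalSequence K) :
    IsNormableTopology (tau v K) ↔ ∃ L, WeightDominates (weightAddIndicator v L) K := by
  have hle := fun p => withSeminorms_le_iff (monotone_compactSeminorm_add v hK)
    (withSeminorms_tau v K) (withSeminorms_seminormTopology p)
  have hge := fun p => withSeminorms_le_iff (fun _ _ _ => le_rfl)
    (withSeminorms_seminormTopology p) (withSeminorms_tau v K)
  constructor
  · rintro ⟨p, -, hp⟩
    obtain ⟨n, C, hC⟩ := (hle p).1 hp.le ()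
    refine ⟨K n, fun m => ?_⟩
    obtain ⟨-, D, hD⟩ := (hge p).1 hp.ge m
    refine ⟨|D| * (|C| * 2), fun f => ?_⟩
    have hf : f.1 ∈ WeightedHol v := weightedHol_weightAddIndicator v (K n) ▸ f.2
    calc compactSeminorm _ (K m) f = compactSeminorm v (K m) ⟨f.1, hf⟩ := rfl
      _ ≤ compactSeminorm v (K m) ⟨f.1, hf⟩ + weightSeminorm v ⟨f.1, hf⟩ :=
        le_add_of_nonneg_right (apply_nonneg _ _)
      _ ≤ D * p ⟨f.1, hf⟩ := hD _
      _ ≤ |D| * p ⟨f.1, hf⟩ := by gcongr; exact le_abs_self D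
      _ ≤ |D| * (|C| * (compactSeminorm v (K n) ⟨f.1, hf⟩ + weightSeminorm v ⟨f.1, hf⟩)) := by
        gcongr
        refine (hC _).trans ?_
        exact mul_le_mul_of_nonneg_right (le_abs_self C) (apply_nonneg _ _)
      _ ≤ |D| * (|C| * (2 * weightSeminorm (weightAddIndicator v (K n)) f)) := by
        gcongr
        rw [two_mul]
        exact add_le_add (compactSeminorm_le_weightAddIndicator hf f.2)
          (weightSeminorm_le_weightAddIndicator hf f.2)
      _ = _ := by ring
  · rintro ⟨L, hL⟩
    have hdom : ∀ n, ∃ C : ℝ, ∀ f, compactSeminorm v (K n) f ≤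
        C * (compactSeminorm v L + weightSeminorm v) f := by
      intro n
      obtain ⟨C, hC⟩ := hL n
      refine ⟨|C|, fun f => ?_⟩
      have hf : f.1 ∈ WeightedHol (weightAddIndicator v L) :=
        (weightedHol_weightAddIndicator v L).symm ▸ f.2
      calc compactSeminorm v (K n) f ≤ C * weightSeminorm _ ⟨f.1, hf⟩ := hC ⟨f.1, hf⟩
        _ ≤ |C| * weightSeminorm _ ⟨f.1, hf⟩ := by gcongr; exact le_abs_self C
        _ ≤ _ := by
          gcongr
          exact weightSeminorm_weightAddIndicator_le f.2 hf
    refine ⟨_, seminormIsNorm_of_dominates hK hdom, le_antisymm ?_ ?_⟩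
    · refine (hle _).2 fun _ => ?_
      obtain ⟨n, hn⟩ := hK.exists_le L
      refine ⟨n, 1, fun f => ?_⟩
      rw [one_mul]
      exact add_le_add (compactSeminorm_mono v hn f) le_rfl
    · refine (hge _).2 fun n => ?_
      obtain ⟨C, hC⟩ := hdom n
      refine ⟨(), C + 1, fun f => ?_⟩
      rw [add_one_mul]
      exact add_le_add (hC f) (le_add_of_nonneg_left (apply_nonneg _ _))

end WeightedSpaces

/-! ### Completeness and domination of compact suprema -/

section BanachCharacterization

variable {G : Set ℂ}

theorem accPt_subtype_iff {E : Set G} {z : G} :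
    AccPt z (𝓟 E) ↔ AccPt (z : ℂ) (𝓟 ((↑) '' E)) := by
  constructor
  · intro h
    rw [accPt_iff_nhds] at h ⊢
    intro U hU
    obtain ⟨y, ⟨hyU, hyE⟩, hy⟩ := h _ (continuous_subtype_val.continuousAt.preimage_mem_nhds hU)
    exact ⟨y, ⟨hyU, mem_image_of_mem _ hyE⟩, fun e => hy (Subtype.ext e)⟩
  · intro h
    rw [accPt_iff_nhds] at h ⊢
    intro U hU
    obtain ⟨V, hV, hVU⟩ := mem_nhds_subtype _ _ _ |>.1 hU
    obtain ⟨_, ⟨hyV, y, hyE, rfl⟩, hy⟩ := h V hV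
    exact ⟨y, ⟨hVU hyV, hyE⟩, fun e => hy (congrArg _ e)⟩

/-- If the positivity set of the weight has no limit point, some nonzero holomorphic function
vanishes on it. -/
theorem HasNoLimitPoint.exists_holomorphic {E : Set G} (hE : HasNoLimitPoint E) (hGo : IsOpen G)
    (hGn : G.Nonempty) :
    ∃ h : ℂ → ℂ, DifferentiableOn ℂ h G ∧ (∃ p ∈ G, h p ≠ 0) ∧ ∀ z ∈ E, h z = 0 := by
  have hS : ∀ z ∈ G, ¬ AccPt z (𝓟 ((↑) '' E : Set ℂ)) :=
    fun z hz hacc => hE ⟨z, hz⟩ (accPt_subtype_iff.2 hacc)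
  obtain ⟨x, hx⟩ := hGn
  have h1 : ∀ᶠ y in 𝓝[≠] x, y ∉ ((↑) '' E : Set ℂ) := by
    have := hS x hx
    rw [accPt_iff_frequently_nhdsNE, not_frequently] at this
    exact this
  obtain ⟨p, hpE, hpG⟩ := (h1.and (nhdsWithin_le_nhds (hGo.mem_nhds hx))).exists
  obtain ⟨h, hd, hp, h0⟩ := exists_holomorphic_zero_on hGo hS hpG hpE
  exact ⟨h, hd, ⟨p, hpG, hp⟩, fun z hz => h0 z (mem_image_of_mem _ hz) z.2⟩

theorem weightDominates_of_dominates_points {v : G → ℝ≥0} {K : ℕ → Compacts G}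
    (h : ∀ z : G, ∃ C : ℝ, ∀ᶠ y in 𝓝 z, ∀ f : WeightedHol v, ‖f.1 y‖ ≤ C * weightSeminorm v f) :
    WeightDominates v K := by
  intro n
  have key : ∃ C : ℝ, 0 ≤ C ∧
      ∀ y ∈ (K n : Set G), ∀ f : WeightedHol v, ‖f.1 y‖ ≤ C * weightSeminorm v f := by
    refine (K n).isCompact.induction_on (p := fun s => ∃ C : ℝ, 0 ≤ C ∧
      ∀ y ∈ s, ∀ f : WeightedHol v, ‖f.1 y‖ ≤ C * weightSeminorm v f) ⟨0, le_rfl, by simp⟩ ?_ ?_ ?_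
    · rintro s t hst ⟨C, hC, h⟩
      exact ⟨C, hC, fun y hy => h y (hst hy)⟩
    · rintro s t ⟨C, hC0, hC⟩ ⟨D, hD0, hD⟩
      refine ⟨max C D, hC0.trans (le_max_left _ _), fun y hy f => ?_⟩
      have hf : 0 ≤ weightSeminorm v f := apply_nonneg _ _
      rcases hy with hy | hy
      · exact (hC y hy f).trans (by gcongr; exact le_max_left _ _)
      · exact (hD y hy f).trans (by gcongr; exact le_max_right _ _)
    · intro z _
      obtain ⟨C, hC⟩ := h z
      refine ⟨_, mem_nhdsWithin_of_mem_nhds hC, |C|, abs_nonneg C, fun y hy f => (hy f).trans ?_⟩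
      have hf : 0 ≤ weightSeminorm v f := apply_nonneg _ _
      gcongr
      exact le_abs_self C
  obtain ⟨C, hC0, hC⟩ := key
  exact ⟨C, fun f => compactSeminorm_le f (mul_nonneg hC0 (apply_nonneg _ _))
    fun z hz => hC z hz f⟩

/-- Restriction of continuous functions on `G` to a subset, as a linear map. -/
noncomputable def restrictLinearMap (v : G → ℝ≥0) {B : Set ℂ} (hB : B ⊆ G) : WeightedHol v →ₗ[ℂ] C(B, ℂ) where
  toFun f := f.1.comp ⟨Set.inclusion hB, continuous_inclusion hB⟩
  map_add' _ _ := rfl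
  map_smul' _ _ := rfl

/-- On a closed disc whose interior contains a limit point of points with continuous evaluation,
evaluations are uniformly bounded. -/
theorem SeminormIsBanach.bound_on_closedBall {v : G → ℝ≥0}
    (hv : SeminormIsBanach (weightSeminorm v)) {x : ℂ} {r : ℝ} (hr : 0 < r)
    (hB : Metric.closedBall x r ⊆ G) {S : Set G}
    (hS : ∀ z ∈ S, ∃ C : ℝ, ∀ f : WeightedHol v, ‖f.1 z‖ ≤ C * weightSeminorm v f) {y : ℂ}
    (hy : y ∈ Metric.ball x r) (hacc : AccPt y (𝓟 ((↑) '' S : Set ℂ))) :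
    ∃ C : ℝ, ∀ z : G, (z : ℂ) ∈ Metric.closedBall x r →
      ∀ f : WeightedHol v, ‖f.1 z‖ ≤ C * weightSeminorm v f := by
  have : CompactSpace (Metric.closedBall x r) :=
    isCompact_iff_compactSpace.1 (isCompact_closedBall x r)
  -- If $u_n \to 0$ in norm and uniformly to $g$ on the disc, then $g$ vanishes on the part of $S$
  -- in the open disc, by continuity of the evaluations. The identity theorem gives $g = 0$ inside,
  -- and continuity gives it on the boundary.
  obtain ⟨C, hC⟩ := hv.bound_of_closed_graph (restrictLinearMap v hB) (by
    intro u g hu hg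
    have hunif := Metric.tendsto_atTop.1 hg
    have hpt : ∀ z : Metric.closedBall x r,
        Tendsto (fun n => (u n).1 ⟨z, hB z.2⟩) atTop (𝓝 (g z)) := fun z =>
      ((continuous_eval_const (F := C(_, _)) z).tendsto g).comp hg
    choose F hFd hF using fun n => (u n).2.1
    classical
    let Y : ℂ → ℂ := fun z => if hz : z ∈ Metric.closedBall x r then g ⟨z, hz⟩ else 0
    have hYg : ∀ z : Metric.closedBall x r, Y z = g z := fun z => dif_pos z.2
    have hYc : ContinuousOn Y (Metric.closedBall x r) := by
      rw [continuousOn_iff_continuous_domRestrict]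
      exact g.continuous.congr fun z => (hYg z).symm
    have hYd : DifferentiableOn ℂ Y (Metric.ball x r) := by
      refine TendstoLocallyUniformlyOn.differentiableOn (F := F) (φ := atTop) ?_
        (.of_forall fun n => (hFd n).mono (Metric.ball_subset_closedBall.trans hB))
        Metric.isOpen_ball
      refine TendstoUniformlyOn.tendstoLocallyUniformlyOn
        (Metric.tendstoUniformlyOn_iff.2 fun ε hε => ?_)
      obtain ⟨N, hN⟩ := hunif ε hε
      filter_upwards [eventually_ge_atTop N] with n hn z hz
      have hz' := Metric.ball_subset_closedBall hz
      have h1 : Y z = g ⟨z, hz'⟩ := hYg ⟨z, hz'⟩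
      have h2 : F n z = restrictLinearMap v hB (u n) ⟨z, hz'⟩ := hF n ⟨z, hB hz'⟩
      rw [h1, h2, dist_comm]
      exact (ContinuousMap.dist_apply_le_dist _).trans_lt (hN n hn)
    have hY0 : ∃ᶠ z in 𝓝[≠] y, Y z = 0 := by
      rw [accPt_iff_frequently_nhdsNE] at hacc
      refine (hacc.and_eventually (nhdsWithin_le_nhds
        (Metric.isOpen_ball.mem_nhds hy))).mono ?_
      rintro _ ⟨⟨z, hzS, rfl⟩, hzB⟩
      have hz' := Metric.ball_subset_closedBall hzB
      obtain ⟨C, hC⟩ := hS z hzS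
      have h1 : Y z = g ⟨z, hz'⟩ := hYg ⟨z, hz'⟩
      rw [h1]
      refine tendsto_nhds_unique (hpt ⟨z, hz'⟩) (squeeze_zero_norm (fun n => hC (u n)) ?_)
      simpa using hu.const_mul C
    have hzero : EqOn Y 0 (Metric.ball x r) :=
      (hYd.analyticOnNhd Metric.isOpen_ball).eqOn_zero_of_preconnected_of_frequently_eq_zero
        (convex_ball x r).isPreconnected hy hY0
    have hzero' : EqOn Y 0 (Metric.closedBall x r) :=
      hzero.of_subset_closure hYc continuousOn_const Metric.ball_subset_closedBall
        (closure_ball x hr.ne').ge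
    ext z
    rw [← hYg z]
    exact hzero' z.2)
  exact ⟨C, fun z hz f =>
    ((restrictLinearMap v hB f).norm_coe_le_norm ⟨z, hz⟩).trans (hC f)⟩

theorem SeminormIsBanach.weightDominates {v : G → ℝ≥0} (hGo : IsOpen G) (hGc : IsConnected G)
    (hv : SeminormIsBanach (weightSeminorm v)) (K : ℕ → Compacts G) : WeightDominates v K := by
  have hlim : ¬ HasNoLimitPoint (positivitySet v) := by
    intro hno
    obtain ⟨h, hd, ⟨p, hpG, hp⟩, h0⟩ := hno.exists_holomorphic hGo hGc.nonempty
    have hz : ∀ z : G, (v z : ℝ) * ‖holomorphicRestrict hd z‖ = 0 := by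
      intro z
      rcases (zero_le (a := v z)).eq_or_lt with hvz | hvz
      · simp [← hvz]
      · have : holomorphicRestrict hd z = 0 := h0 z hvz
        simp [this]
    let f : WeightedHol v := ⟨holomorphicRestrict hd, holomorphicRestrict_mem hd, 0, by
      rintro _ ⟨z, rfl⟩
      exact (hz z).le⟩
    have hf : f = 0 := hv.1 f (le_antisymm
      (weightSeminorm_le f le_rfl fun z => (hz z).le) (apply_nonneg _ _))
    exact hp (congrArg (fun f : WeightedHol v => f.1 ⟨p, hpG⟩) hf)
  simp only [HasNoLimitPoint, not_forall, not_not] at hlim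
  obtain ⟨z₀, hz₀⟩ := hlim
  -- `T` is the open set of points near which evaluations are uniformly bounded. It contains the
  -- limit point of $E_v$ and is relatively closed in $G$: a disc about a point of its closure
  -- contains a point of `T`, at which `T` accumulates.
  let T : Set ℂ := {z | ∃ C : ℝ, ∀ᶠ y in 𝓝 z, ∃ hy : y ∈ G, ∀ f : WeightedHol v,
    ‖f.1 ⟨y, hy⟩‖ ≤ C * weightSeminorm v f}
  have hTo : IsOpen T := by
    refine isOpen_iff_mem_nhds.2 fun z ⟨C, hC⟩ => ?_
    filter_upwards [eventually_eventually_nhds.2 hC] with y hy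
    exact ⟨C, hy⟩
  have hTball : ∀ x r, 0 < r → Metric.closedBall x r ⊆ G → (∃ C : ℝ, ∀ z : G,
      (z : ℂ) ∈ Metric.closedBall x r → ∀ f : WeightedHol v,
        ‖f.1 z‖ ≤ C * weightSeminorm v f) → x ∈ T := by
    rintro x r hr hB ⟨C, hC⟩
    refine ⟨C, ?_⟩
    filter_upwards [Metric.closedBall_mem_nhds x hr] with y hy
    exact ⟨hB hy, hC ⟨y, hB hy⟩ hy⟩
  have hball : ∀ x ∈ G, ∃ r > 0, Metric.closedBall x r ⊆ G := fun x hx =>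
    Metric.nhds_basis_closedBall.mem_iff.1 (hGo.mem_nhds hx)
  have hGT : G ⊆ T := by
    refine hGc.isPreconnected.subset_of_closure_inter_subset hTo ⟨z₀, z₀.2, ?_⟩ ?_
    · obtain ⟨r, hr, hB⟩ := hball z₀ z₀.2
      refine hTball z₀ r hr hB (hv.bound_on_closedBall hr hB (S := positivitySet v) ?_
        (Metric.mem_ball_self hr) (accPt_subtype_iff.1 hz₀))
      intro z hz
      have hvz : (0 : ℝ) < v z := hz
      refine ⟨(v z : ℝ)⁻¹, fun f => ?_⟩
      rw [inv_mul_eq_div, le_div_iff₀ hvz, mul_comm]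
      exact le_weightSeminorm f z
    · rintro x ⟨hxT, hxG⟩
      obtain ⟨r, hr, hB⟩ := hball x hxG
      obtain ⟨y, hyT, hyx⟩ := Metric.mem_closure_iff.1 hxT r hr
      rw [dist_comm] at hyx
      refine hTball x r hr hB (hv.bound_on_closedBall hr hB (S := (↑) ⁻¹' T) ?_
        (y := y) hyx ?_)
      · rintro z ⟨C, hC⟩
        obtain ⟨_, h⟩ := hC.self_of_nhds
        exact ⟨C, h⟩
      · rw [accPt_iff_frequently_nhdsNE]
        refine Eventually.frequently ?_
        obtain ⟨C, hC⟩ := hyT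
        refine nhdsWithin_le_nhds ?_
        filter_upwards [hC, hTo.mem_nhds ⟨C, hC⟩] with w hw hwT
        exact ⟨⟨w, hw.1⟩, hwT, rfl⟩
  refine weightDominates_of_dominates_points fun z => ?_
  obtain ⟨C, hC⟩ := hGT z.2
  refine ⟨C, ?_⟩
  filter_upwards [continuous_subtype_val.continuousAt.eventually hC] with y hy
  exact hy.2

theorem WeightDominates.seminormIsBanach {v : G → ℝ≥0} {K : ℕ → Compacts G} (hGo : IsOpen G)
    (hK : IsFundamentalSequence K) (h : WeightDominates v K) :
    SeminormIsBanach (weightSeminorm v) := by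
  refine ⟨seminormIsNorm_of_dominates hK h, seminorm_completeSpace fun u hu => ?_⟩
  choose F hFd hF using fun n => (u n).2.1
  have hcauchy : ∀ n, ∀ ε > 0, ∃ N, ∀ i ≥ N, ∀ j ≥ N, ∀ z ∈ K n,
      ‖(u i).1 z - (u j).1 z‖ < ε := by
    intro n ε hε
    obtain ⟨C, hC⟩ := h n
    obtain ⟨N, hN⟩ := hu (ε / (|C| + 1)) (by positivity)
    refine ⟨N, fun i hi j hj z hz => ?_⟩
    calc ‖(u i).1 z - (u j).1 z‖ ≤ compactSeminorm v (K n) (u i - u j) :=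
          le_compactSeminorm (u i - u j) hz
      _ ≤ C * weightSeminorm v (u i - u j) := hC _
      _ ≤ (|C| + 1) * weightSeminorm v (u i - u j) := by
        gcongr
        linarith [le_abs_self C]
      _ < (|C| + 1) * (ε / (|C| + 1)) := by
        gcongr
        exact hN i hi j hj
      _ = ε := by field_simp
  have hlim : ∀ z : ℂ, ∃ w, ∀ hz : z ∈ G,
      Tendsto (fun n => (u n).1 ⟨z, hz⟩) atTop (𝓝 w) := by
    intro z
    by_cases hz : z ∈ G
    · obtain ⟨n, hn⟩ := hK.exists_mem ⟨z, hz⟩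
      have : CauchySeq fun n => (u n).1 ⟨z, hz⟩ := Metric.cauchySeq_iff.2 fun ε hε => by
        obtain ⟨N, hN⟩ := hcauchy n ε hε
        exact ⟨N, fun i hi j hj => by rw [dist_eq_norm]; exact hN i hi j hj _ hn⟩
      obtain ⟨w, hw⟩ := cauchySeq_tendsto_of_complete this
      exact ⟨w, fun _ => hw⟩
    · exact ⟨0, fun h => absurd h hz⟩
  choose g hg using hlim
  have hgd : DifferentiableOn ℂ g G := by
    refine TendstoLocallyUniformlyOn.differentiableOn (F := F) (φ := atTop) ?_
      (.of_forall hFd) hGo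
    rw [tendstoLocallyUniformlyOn_iff_forall_isCompact hGo]
    intro L hLG hL
    obtain ⟨n, hn⟩ := hK.exists_le (compactsOfSubset hL hLG)
    refine UniformCauchySeqOn.tendstoUniformlyOn_of_tendsto
      (Metric.uniformCauchySeqOn_iff.2 fun ε hε => ?_) fun z hz => ?_
    · obtain ⟨N, hN⟩ := hcauchy n ε hε
      refine ⟨N, fun i hi j hj z hz => ?_⟩
      have hzn : (⟨z, hLG hz⟩ : G) ∈ K n := hn hz
      have h1 := hN i hi j hj _ hzn
      rwa [← hF, ← hF, ← dist_eq_norm] at h1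
    · exact (hg z (hLG hz)).congr fun n => (hF n ⟨z, hLG hz⟩).symm
  -- Letting $m \to \infty$ pointwise in the Cauchy estimate keeps `N` independent of $z$, with no
  -- regularity of $v$.
  have hest : ∀ ε > 0, ∃ N, ∀ n ≥ N, ∀ z : G, (v z : ℝ) * ‖(u n).1 z - g z‖ ≤ ε := by
    intro ε hε
    obtain ⟨N, hN⟩ := hu ε hε
    refine ⟨N, fun n hn z => ?_⟩
    have ht : Tendsto (fun m => (v z : ℝ) * ‖(u n).1 z - (u m).1 z‖) atTop
        (𝓝 ((v z : ℝ) * ‖(u n).1 z - g z‖)) :=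
      ((hg z z.2).const_sub _).norm.const_mul _
    refine le_of_tendsto ht ((eventually_ge_atTop N).mono fun m hm => ?_)
    exact (le_weightSeminorm (u n - u m) z).trans (hN n hn m hm).le
  have hmem : holomorphicRestrict hgd ∈ WeightedHol v := by
    obtain ⟨N, hN⟩ := hest 1 one_pos
    refine ⟨holomorphicRestrict_mem hgd, weightSeminorm v (u N) + 1, ?_⟩
    rintro _ ⟨z, rfl⟩
    have h1 := hN N le_rfl z
    have h2 := le_weightSeminorm (u N) z
    have h3 : ‖g z‖ ≤ ‖(u N).1 z‖ + ‖(u N).1 z - g z‖ := by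
      simpa using norm_sub_le ((u N).1 z) ((u N).1 z - g z)
    have h4 := mul_le_mul_of_nonneg_left h3 (v z).coe_nonneg
    rw [mul_add] at h4
    exact h4.trans (add_le_add h2 h1)
  refine ⟨⟨_, hmem⟩, fun ε hε => ?_⟩
  obtain ⟨N, hN⟩ := hest (ε / 2) (half_pos hε)
  exact ⟨N, fun n hn => (weightSeminorm_le _ (half_pos hε).le (hN n hn)).trans_lt (half_lt_self hε)⟩

end BanachCharacterization

/-! ### Comparison with the compact-open topology -/

section CompactOpen

variable {G : Set ℂ} {v : G → ℝ≥0} {K : ℕ → Compacts G}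

theorem tau_eq_tauCo (hK : IsFundamentalSequence K) {L : Compacts G}
    (hL : positivitySet v ⊆ L) (hv : BddAbove (Set.range v)) : tau v K = tauCo v := by
  obtain ⟨M, hM⟩ := hv
  have hws : ∀ f, weightSeminorm v f ≤ M * compactSeminorm v L f := fun f => by
    refine weightSeminorm_le f (mul_nonneg M.coe_nonneg (apply_nonneg _ _)) fun z => ?_
    rcases (zero_le (a := v z)).eq_or_lt with hz | hz
    · rw [← hz, NNReal.coe_zero, zero_mul]
      exact mul_nonneg M.coe_nonneg (apply_nonneg _ _)
    · exact mul_le_mul (mod_cast hM ⟨z, rfl⟩) (le_compactSeminorm f (hL hz)) (norm_nonneg _)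
        M.coe_nonneg
  refine le_antisymm ?_ ?_
  · refine (withSeminorms_le_iff (monotone_compactSeminorm_add v hK) (withSeminorms_tau v K)
      (withSeminorms_tauCo v hK)).2 fun n => ⟨n, 1, fun f => ?_⟩
    rw [one_mul]
    exact le_add_of_nonneg_right (apply_nonneg _ _)
  · refine (withSeminorms_le_iff (fun _ _ h => compactSeminorm_mono v (hK.monotone h))
      (withSeminorms_tauCo v hK) (withSeminorms_tau v K)).2 fun n => ?_
    obtain ⟨m, hm⟩ := hK.exists_le (K n ⊔ L)
    refine ⟨m, 1 + M, fun f => ?_⟩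
    rw [add_mul, one_mul]
    refine add_le_add (compactSeminorm_mono v (le_sup_left.trans hm) f) ((hws f).trans ?_)
    exact mul_le_mul_of_nonneg_left (compactSeminorm_mono v (le_sup_right.trans hm) f)
      M.coe_nonneg

theorem bddAbove_of_polynomials_mem
    (hpoly : ∀ p : Polynomial ℂ, p.toContinuousMapOn G ∈ WeightedHol v) :
    BddAbove (Set.range v) := by
  obtain ⟨C, hC⟩ := (hpoly 1).2
  refine ⟨C.toNNReal, ?_⟩
  rintro _ ⟨z, rfl⟩
  exact NNReal.le_toNNReal_of_coe_le (by simpa using hC ⟨z, rfl⟩)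

/-- Continuity of the weight seminorm for $\tau_{co}$ gives $\|f\|_v \le C\sup_{K_n}|f|$. Applied to
$P^k$ with $P(z)=1$ and $|P| \le ρ < 1$ on $K_n$, this forces $v(z) = 0$. -/
theorem positivitySet_subset_polynomialHull (hK : IsFundamentalSequence K)
    (hpoly : ∀ p : Polynomial ℂ, p.toContinuousMapOn G ∈ WeightedHol v)
    (hle : tauCo v ≤ tau v K) :
    ∃ n, ∀ z ∈ positivitySet v, (z : ℂ) ∈ polynomialHull ((↑) '' (K n : Set G)) := by
  obtain ⟨n, C, hC⟩ := (withSeminorms_le_iff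
    (fun _ _ h => compactSeminorm_mono v (hK.monotone h))
    -- The index $0$ is arbitrary: only the weight part of the seminorm is used.
    (withSeminorms_tauCo v hK) (withSeminorms_tau v K)).1 hle 0
  refine ⟨n, fun z hz => ?_⟩
  by_contra hzn
  obtain ⟨P, ρ, hρ0, hρ1, hPz, hP⟩ := exists_polynomial_of_notMem_polynomialHull hzn
  have hbound : ∀ k : ℕ, (v z : ℝ) ≤ |C| * ρ ^ k := by
    intro k
    let f : WeightedHol v := ⟨(P ^ k).toContinuousMapOn G, hpoly (P ^ k)⟩
    have hfz : ‖f.1 z‖ = 1 := by simp [f, hPz]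
    calc (v z : ℝ) = v z * ‖f.1 z‖ := by rw [hfz, mul_one]
      _ ≤ weightSeminorm v f := le_weightSeminorm f z
      _ ≤ compactSeminorm v (K 0) f + weightSeminorm v f :=
        le_add_of_nonneg_left (apply_nonneg _ _)
      _ ≤ C * compactSeminorm v (K n) f := hC f
      _ ≤ |C| * compactSeminorm v (K n) f := by gcongr; exact le_abs_self C
      _ ≤ |C| * ρ ^ k := by
        gcongr
        refine compactSeminorm_le f (by positivity) fun y hy => ?_
        have : ‖f.1 y‖ = ‖P.eval (y : ℂ)‖ ^ k := by simp [f]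
        rw [this]
        exact pow_le_pow_left₀ (norm_nonneg _) (hP y (mem_image_of_mem _ hy)) k
  have hlim : Tendsto (fun k : ℕ => |C| * ρ ^ k) atTop (𝓝 0) := by
    simpa using (tendsto_pow_atTop_nhds_zero_of_lt_one hρ0 hρ1).const_mul |C|
  have h0 : (v z : ℝ) ≤ 0 := ge_of_tendsto' hlim hbound
  exact absurd h0 (not_le.2 hz)

theorem exists_compacts_of_tau_eq_tauCo (hGo : IsOpen G) (hGs : IsSimplyConnected G)
    (hK : IsFundamentalSequence K)
    (hpoly : ∀ p : Polynomial ℂ, p.toContinuousMapOn G ∈ WeightedHol v)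
    (heq : tau v K = tauCo v) : ∃ L : Compacts G, positivitySet v ⊆ L := by
  obtain ⟨n, hn⟩ := positivitySet_subset_polynomialHull hK hpoly heq.ge
  have hKc : IsCompact ((↑) '' (K n : Set G) : Set ℂ) :=
    (K n).isCompact.image continuous_subtype_val
  exact ⟨compactsOfSubset (isCompact_polynomialHull hKc)
    (polynomialHull_subset_of_isSimplyConnected hGo hGs hKc (by rintro _ ⟨z, -, rfl⟩; exact z.2)),
    hn⟩

end CompactOpen

/-! ### Normability forces a limit point -/

section LimitPoints

variable {G : Set ℂ}

/-- Every nonempty open set carries an unbounded holomorphic function. -/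
theorem exists_unbounded_holomorphic (hGo : IsOpen G) (hGn : G.Nonempty) :
    ∃ g : ℂ → ℂ, DifferentiableOn ℂ g G ∧ ∀ R : ℝ, ∃ z ∈ G, R < ‖g z‖ := by
  by_cases hG : G = univ
  · subst hG
    refine ⟨id, differentiableOn_id, fun R => ?_⟩
    obtain ⟨z, hz⟩ := NormedField.exists_lt_norm ℂ R
    exact ⟨z, mem_univ z, hz⟩
  · obtain ⟨a, ha⟩ : (frontier G).Nonempty := nonempty_frontier_iff.2 ⟨hGn, hG⟩
    rw [hGo.frontier_eq] at ha
    have hne : ∀ z ∈ G, z - a ≠ 0 := fun z hz h => ha.2 (sub_eq_zero.1 h ▸ hz)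
    refine ⟨fun z => (z - a)⁻¹, DifferentiableOn.inv (by fun_prop) hne, fun R => ?_⟩
    obtain ⟨z, hz, hza⟩ := Metric.mem_closure_iff.1 ha.1 (|R| + 1)⁻¹ (by positivity)
    refine ⟨z, hz, ?_⟩
    rw [dist_comm, dist_eq_norm] at hza
    rw [norm_inv]
    have := (lt_inv_comm₀ (norm_pos_iff.2 (hne z hz)) (by positivity)).1 hza
    linarith [le_abs_self R]

/-- Otherwise $h$ would vanish on the nonempty open set $\{|g| > R\}$, hence on all of $G$. -/
theorem exists_mem_ne_zero_lt_norm (hGo : IsOpen G) (hGc : IsConnected G) {h g : ℂ → ℂ}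
    (hh : DifferentiableOn ℂ h G) (hg : DifferentiableOn ℂ g G) (hne : ∃ p ∈ G, h p ≠ 0) {R : ℝ}
    (hR : ∃ z ∈ G, R < ‖g z‖) : ∃ z ∈ G, h z ≠ 0 ∧ R < ‖g z‖ := by
  obtain ⟨z, hz, hgz⟩ := hR
  obtain ⟨p, hp, hhp⟩ := hne
  have hev : ∀ᶠ y in 𝓝[≠] z, y ∈ G ∧ R < ‖g y‖ :=
    nhdsWithin_le_nhds ((hGo.eventually_mem hz).and
      ((hg.continuousOn.continuousAt (hGo.mem_nhds hz)).norm.eventually (lt_mem_nhds hgz)))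
  by_contra! hcon
  have hzero : ∀ᶠ y in 𝓝[≠] z, h y = 0 := by
    filter_upwards [hev] with y hy
    by_contra hhy
    exact absurd hy.2 (not_lt.2 (hcon y hy.1 hhy))
  exact hhp ((hh.analyticOnNhd hGo).eqOn_zero_of_preconnected_of_frequently_eq_zero
    hGc.isPreconnected hz hzero.frequently hp)

/-- A function $h$ vanishing on $E_v$ need not have norm zero, since $\chi_L$ also sees it. But $h
g^k$ has norm at most $A R^k$, with $A$ and $R$ bounding $|h|$ and $|g|$ on $L$, while at a point
with $|g(z)| > R$ and $h(z) \ne 0$ it grows like $|g(z)|^k$. -/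
theorem WeightDominates.not_hasNoLimitPoint {v : G → ℝ≥0} {K : ℕ → Compacts G} {L : Compacts G}
    (hGo : IsOpen G) (hGc : IsConnected G) (hK : IsFundamentalSequence K)
    (hdom : WeightDominates (weightAddIndicator v L) K) :
    ¬ HasNoLimitPoint (positivitySet v) := by
  intro hno
  obtain ⟨h, hhd, hne, h0⟩ := hno.exists_holomorphic hGo hGc.nonempty
  obtain ⟨g, hgd, hgunb⟩ := exists_unbounded_holomorphic hGo hGc.nonempty
  have hbdd : ∀ {F : ℂ → ℂ}, DifferentiableOn ℂ F G → ∃ C : ℝ, 0 < C ∧ ∀ z ∈ L, ‖F z‖ ≤ C := by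
    intro F hF
    obtain ⟨C, hC0, hC⟩ :=
      (L.isCompact.image (holomorphicRestrict hF).continuous).isBounded.exists_pos_norm_le
    exact ⟨C, hC0, fun z hz => hC _ (mem_image_of_mem _ hz)⟩
  obtain ⟨A, hA0, hA⟩ := hbdd hhd
  obtain ⟨R, hR0, hR⟩ := hbdd hgd
  obtain ⟨z, hzG, hhz, hgz⟩ := exists_mem_ne_zero_lt_norm hGo hGc hhd hgd hne (hgunb R)
  obtain ⟨n, hn⟩ := hK.exists_mem ⟨z, hzG⟩
  obtain ⟨C, hC⟩ := hdom n
  have hbound : ∀ k : ℕ, ‖h z‖ ≤ |C| * A * (R / ‖g z‖) ^ k := by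
    intro k
    have hFd : DifferentiableOn ℂ (fun z => h z * g z ^ k) G := hhd.mul (hgd.pow k)
    have hle : ∀ y : G, (weightAddIndicator v L y : ℝ) * ‖holomorphicRestrict hFd y‖ ≤
        A * R ^ k := by
      intro y
      have heq : ‖holomorphicRestrict hFd y‖ = ‖h y‖ * ‖g y‖ ^ k := by
        rw [← norm_pow, ← norm_mul]
        rfl
      by_cases hy : 0 < v y
      · rw [heq, h0 y hy, norm_zero, zero_mul, mul_zero]
        positivity
      · have hvy : v y = 0 := le_antisymm (not_lt.1 hy) zero_le
        by_cases hyL : y ∈ L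
        · rw [heq, weightAddIndicator, hvy,
            Set.indicator_of_mem (show y ∈ (L : Set G) from hyL), zero_add, NNReal.coe_one, one_mul]
          gcongr
          · exact hA y hyL
          · exact hR y hyL
        · rw [weightAddIndicator, hvy, Set.indicator_of_notMem (show y ∉ (L : Set G) from hyL),
            zero_add, NNReal.coe_zero, zero_mul]
          positivity
    let f : WeightedHol (weightAddIndicator v L) :=
      ⟨holomorphicRestrict hFd, holomorphicRestrict_mem hFd, A * R ^ k, by
        rintro _ ⟨y, rfl⟩
        exact hle y⟩
    have hgz0 : 0 < ‖g z‖ := hR0.trans hgz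
    have h1 : ‖h z‖ * ‖g z‖ ^ k ≤ |C| * (A * R ^ k) := by
      calc ‖h z‖ * ‖g z‖ ^ k = ‖f.1 ⟨z, hzG⟩‖ := by
            rw [← norm_pow, ← norm_mul]
            rfl
        _ ≤ compactSeminorm _ (K n) f := le_compactSeminorm f hn
        _ ≤ C * weightSeminorm _ f := hC f
        _ ≤ |C| * weightSeminorm _ f := by gcongr; exact le_abs_self C
        _ ≤ |C| * (A * R ^ k) := by
          gcongr
          exact weightSeminorm_le f (by positivity) hle
    rw [div_pow, ← mul_div_assoc, le_div_iff₀ (by positivity)]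
    linarith
  have hlim : Tendsto (fun k : ℕ => |C| * A * (R / ‖g z‖) ^ k) atTop (𝓝 0) := by
    simpa using (tendsto_pow_atTop_nhds_zero_of_lt_one (by positivity)
      ((div_lt_one (hR0.trans hgz)).2 hgz)).const_mul (|C| * A)
  exact hhz (norm_le_zero_iff.1 (ge_of_tendsto' hlim hbound))

end LimitPoints

theorem proposition2p7 (G : Set ℂ) (hGo : IsOpen G) (hGc : IsConnected G) (v : G → ℝ≥0)
    (K : ℕ → TopologicalSpace.Compacts G) (hK : IsFundamentalSequence K) :
    -- (i); in Mathlib's order on topologies, `t ≤ s` means that `s` is coarser than `t`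
    ((tauV v ≤ tau v K ↔ tau v K = tauV v) ∧
      (tauV v ≤ tau v K ↔ SeminormIsBanach (weightSeminorm v))) ∧
    -- (ii)
    (IsNormableTopology (tau v K) ↔
      ∃ L : TopologicalSpace.Compacts G, SeminormIsBanach (weightSeminorm (weightAddIndicator v L))) ∧
    -- (iii)
    ((∃ L : TopologicalSpace.Compacts G, positivitySet v ⊆ L) → BddAbove (Set.range v) →
      tau v K = tauCo v) ∧
    ((∀ p : Polynomial ℂ, p.toContinuousMapOn G ∈ WeightedHol v) → IsSimplyConnected G →
      tau v K = tauCo v →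
      (∃ L : TopologicalSpace.Compacts G, positivitySet v ⊆ L) ∧ BddAbove (Set.range v)) ∧
    -- (iv)
    (IsNormableTopology (tau v K) → ¬ HasNoLimitPoint (positivitySet v)) := by
  have hbanach : ∀ w : G → ℝ≥0, WeightDominates w K ↔ SeminormIsBanach (weightSeminorm w) :=
    fun w => ⟨fun h => h.seminormIsBanach hGo hK, fun h => h.weightDominates hGo hGc K⟩
  refine ⟨⟨⟨fun h => le_antisymm (tau_le_tauV v hK) h, fun h => h.ge⟩,
    (tauV_le_tau_iff v).trans (hbanach v)⟩, ?_, ?_, ?_, ?_⟩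
  · simpa only [hbanach] using isNormableTopology_tau_iff v hK
  · rintro ⟨L, hL⟩ hv
    exact tau_eq_tauCo hK hL hv
  · intro hpoly hGs heq
    exact ⟨exists_compacts_of_tau_eq_tauCo hGo hGs hK hpoly heq, bddAbove_of_polynomials_mem hpoly⟩
  · intro h
    obtain ⟨L, hL⟩ := (isNormableTopology_tau_iff v hK).1 h
    exact hL.not_hasNoLimitPoint hGo hGc hK
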